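/- Let $m\ge 1$ be an integer and let $G$ be a finite group. Put $V=\bigcup_{i=1}^m G_i$, where $G_i=\{x_i : x\in G\}$ are $m$ disjoint copies of $G$. For subsets $S_{i,j}\subseteq G$ ($1\le i,j\le m$) with $1\notin S_{i,i}$ for all $i$, the $m$-Cayley digraph $\mathrm{Cay}(G,S_{i,j}:1\le i,j\le m)$ has vertex set $V$ and arc set $\bigcup_{i,j}\{(x_i,(sx)_j) : s\in S_{i,j},\ x\in G\}$; it is called an $m$-Cayley graph if its arc set is symmetric. For $g\in G$ let $R(g)$ be the permutation $x_i\mapsto (xg)_i$ of $V$, let $R(G)=\{R(g):g\in G\}$, and let $N$ be the normalizer of $R(G)$ in the symmetric group on $V$. For a digraph $\Gamma$ on $V$ and $n\in N$ let $\Gamma^n$ be the digraph on $V$ with arc set $\{(u^n,v^n) : (u,v) \text{ an arc of } \Gamma\}$. An $m$-Cayley digraph (respectively graph) $\Gamma$ of $G$ is called $m$CI if for every $m$-Cayley digraph (respectively graph) $\Sigma$ of $G$ isomorphic to $\Gamma$ there is $n\in N$ with $\Gamma^n=\Sigma$. The group $G$ is an $m$DCI-group if every $m$-Cayley digraph of $G$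 is $m$CI, and an $m$CI-group if every $m$-Cayley graph of $G$ is $m$CI. Theorem. Let $m\ge 2$ be an integer and let $G$ be a finite group. Then (1) $G$ is an $m$CI-group if and only if either $m=2$ and $G$ is trivial or isomorphic to $\mathbb{Z}_3$, or $m\ge 3$ and $G$ is trivial; (2) $G$ is an $m$DCI-group if and only if $G$ is trivial. -/

import Mathlib

namespace MCayley

/-- The vertex set `V = G_1 ∪ ⋯ ∪ G_m`; the pair `(i, x)` is the vertex `x_i`. -/
abbrev Vertex (m : ℕ) (G : Type*) : Type _ := Fin m × G

section Digraphs

variable {V : Type*}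

/-- Two digraphs on `V` are isomorphic. -/
def Isomorphic (Γ Δ : Digraph V) : Prop := Nonempty (Γ.Adj ≃r Δ.Adj)

/-- The image `Γ^n` of a digraph under a permutation `n` of its vertices: its arcs are the pairs
`(n u, n v)` with `(u, v)` an arc of `Γ`. -/
def image (Γ : Digraph V) (n : Equiv.Perm V) : Digraph V where
  Adj a b := ∃ u v, Γ.Adj u v ∧ n u = a ∧ n v = b

/-- A digraph is a graph if its arc set is symmetric. -/
def IsGraph (Γ : Digraph V) : Prop := ∀ u v, Γ.Adj u v → Γ.Adj v u

end Digraphs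

section Groups

variable {m : ℕ} {G : Type*} [Group G]

/-- `Cay(G, S_{i,j} : 1 ≤ i, j ≤ m)`: the arcs are the pairs `(x_i, (s x)_j)` with `x ∈ G` and
`s ∈ S_{i,j}`. -/
def cay (S : Fin m → Fin m → Set G) : Digraph (Vertex m G) where
  Adj u v := ∃ i j : Fin m, ∃ x : G, ∃ s ∈ S i j, u = (i, x) ∧ v = (j, s * x)

/-- The `m`-Cayley digraphs of `G`. Digraphs have no loops, hence `1 ∉ S_{i,i}`. -/
def IsMCayleyDigraph (Γ : Digraph (Vertex m G)) : Prop :=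
  ∃ S : Fin m → Fin m → Set G, (∀ i, (1 : G) ∉ S i i) ∧ Γ = cay S

/-- The `m`-Cayley graphs of `G`. -/
def IsMCayleyGraph (Γ : Digraph (Vertex m G)) : Prop :=
  IsMCayleyDigraph Γ ∧ IsGraph Γ

variable (m) in
/-- The permutation `R(g) : x_i ↦ (x g)_i`. -/
def rightMul (g : G) : Equiv.Perm (Vertex m G) where
  toFun u := (u.1, u.2 * g)
  invFun u := (u.1, u.2 * g⁻¹)
  left_inv u := by simp
  right_inv u := by simp

variable (m G) in
/-- The semiregular permutation group `R(G) = {R(g) : g ∈ G}`. -/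
def rightRegular : Subgroup (Equiv.Perm (Vertex m G)) where
  carrier := Set.range (rightMul m)
  one_mem' := ⟨1, by ext u <;> simp [rightMul]⟩
  mul_mem' := by
    rintro _ _ ⟨g, rfl⟩ ⟨h, rfl⟩
    exact ⟨h * g, by ext u <;> simp [rightMul, mul_assoc]⟩
  inv_mem' := by
    rintro _ ⟨g, rfl⟩
    refine ⟨g⁻¹, ?_⟩
    rw [eq_inv_iff_mul_eq_one]
    ext u <;> simp [rightMul]

variable (m G) in
/-- The normalizer of `R(G)` in the symmetric group on the vertex set. -/
def normalizerR : Subgroup (Equiv.Perm (Vertex m G)) :=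
  Subgroup.normalizer (rightRegular m G : Set (Equiv.Perm (Vertex m G)))

/-- An `m`-Cayley digraph `Γ` is `m`CI if every `m`-Cayley digraph of `G` isomorphic to `Γ` is
`Γ^n` for some `n` in the normalizer of `R(G)`. -/
def IsMCIDigraph (Γ : Digraph (Vertex m G)) : Prop :=
  ∀ Δ : Digraph (Vertex m G), IsMCayleyDigraph Δ → Isomorphic Γ Δ →
    ∃ n ∈ normalizerR m G, image Γ n = Δ

/-- An `m`-Cayley graph `Γ` is `m`CI if every `m`-Cayley graph of `G` isomorphic to `Γ` is
`Γ^n` for some `n` in the normalizer of `R(G)`. -/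
def IsMCIGraph (Γ : Digraph (Vertex m G)) : Prop :=
  ∀ Δ : Digraph (Vertex m G), IsMCayleyGraph Δ → Isomorphic Γ Δ →
    ∃ n ∈ normalizerR m G, image Γ n = Δ

variable (m G) in
/-- `G` is an `m`DCI-group: every `m`-Cayley digraph of `G` is `m`CI. -/
def IsMDCIGroup : Prop :=
  ∀ Γ : Digraph (Vertex m G), IsMCayleyDigraph Γ → IsMCIDigraph Γ

variable (m G) in
/-- `G` is an `m`CI-group: every `m`-Cayley graph of `G` is `m`CI. -/
def IsMCIGroup : Prop :=
  ∀ Γ : Digraph (Vertex m G), IsMCayleyGraph Γ → IsMCIGraph Γ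

end Groups

end MCayley

/-!
An element of the normalizer `N` permutes the copies of `G` and turns each `R(g)` into some `R(s)`.
This limits the groups as follows.

* If `σ` is a nontrivial permutation of the copies whose order divides that of `g`, choose
  permutations `c(x)` of the copies with `c(g x) = σ c(x)`. The map `x_i ↦ x_{c(x) i}` turns the
  cycles `x_i — (g x)_i`, each inside one copy, into the cycles `x_i — (g x)_{σ i}`, so it is not
  realized by `N`. Hence every prime dividing the order of an element exceeds `m`.
* Let `H` be an abelian subgroup and join distinct copies of `G` along the cosets of `H`. If `X` and
  `Y` are connection sets in `H` with `Cay(H, X) ≅ Cay(H, Y)`, then putting `X` in all copies, or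
  `Y` in one copy and `X` in the others, gives isomorphic digraphs. An element of `N` mapping one to
  the other takes some `R(a⁻¹ g a)` with `g ∈ X` to an `R(s)` with `s ∈ X ∩ Y`.

With `X = {g}` and `Y = {g⁻¹}`, the second construction shows that an `m`DCI-group has exponent
dividing 2, so it is trivial by the first one. For graphs, `X = {g, g⁻¹}` and `Y = {h, h⁻¹}` show
that commuting elements of equal order are equal or inverse to each other. As the order of `g` is
odd, this applies to `h = g²` and gives `g³ = 1`, and then `m < 3`. In a group of exponent 3 every
element commutes with its conjugates, so it follows that `G` is abelian and has order 3.

Conversely, for `|G| = 3` and `m = 2` the valencies and the presence of a triangle determine the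
connection sets up to `N`.
-/

namespace MCayley

open scoped Pointwise

section Basic

variable {V : Type*} {m : ℕ} {G : Type*} [Group G]

theorem image_eq_iff {Γ Δ : Digraph V} {n : Equiv.Perm V} :
    image Γ n = Δ ↔ ∀ u v, Γ.Adj u v ↔ Δ.Adj (n u) (n v) := by
  constructor
  · rintro rfl u v
    refine ⟨fun h => ⟨u, v, h, rfl, rfl⟩, ?_⟩
    rintro ⟨a, b, h, ha, hb⟩
    rwa [n.injective ha, n.injective hb] at h
  · intro h
    ext a b
    constructor
    · rintro ⟨u, v, huv, rfl, rfl⟩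
      exact (h u v).1 huv
    · intro hab
      exact ⟨n.symm a, n.symm b, (h _ _).2 (by simpa using hab), by simp, by simp⟩

theorem cay_adj {S : Fin m → Fin m → Set G} {u v : Vertex m G} :
    (cay S).Adj u v ↔ v.2 * u.2⁻¹ ∈ S u.1 v.1 := by
  constructor
  · rintro ⟨i, j, x, s, hs, rfl, rfl⟩
    simpa using hs
  · intro h
    exact ⟨u.1, v.1, u.2, _, h, rfl, by simp⟩

theorem isGraph_cay_iff {S : Fin m → Fin m → Set G} :
    IsGraph (cay S) ↔ ∀ i j, (S i j)⁻¹ = S j i := by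
  constructor
  · intro h
    have inv_subset (i j : Fin m) : S i j ⊆ (S j i)⁻¹ := fun s hs => by
      simpa [cay_adj] using h (i, 1) (j, s) (cay_adj.2 (by simpa using hs))
    exact fun i j => (Set.inv_subset.2 (inv_subset i j)).antisymm (inv_subset j i)
  · intro h u v huv
    rw [cay_adj] at huv ⊢
    simpa [← h u.1 v.1] using huv

theorem isMCayleyGraph_cay {S : Fin m → Fin m → Set G} (h_one : ∀ i, (1 : G) ∉ S i i)
    (h_inv : ∀ i j, (S i j)⁻¹ = S j i) : IsMCayleyGraph (cay S) :=
  ⟨⟨S, h_one, rfl⟩, isGraph_cay_iff.2 h_inv⟩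

theorem exists_apply_mul_of_mem_normalizerR {n : Equiv.Perm (Vertex m G)}
    (hn : n ∈ normalizerR m G) (g : G) :
    ∃ s : G, ∀ i x, n (i, x * g) = ((n (i, x)).1, (n (i, x)).2 * s) := by
  obtain ⟨s, hs⟩ := (Subgroup.mem_normalizer_iff.1 hn (rightMul m g)).1 ⟨g, rfl⟩
  refine ⟨s, fun i x => ?_⟩
  simpa [rightMul] using (Equiv.congr_fun hs (n (i, x))).symm

theorem fst_apply_eq_of_mem_normalizerR {n : Equiv.Perm (Vertex m G)} (hn : n ∈ normalizerR m G)
    (i : Fin m) (x y : G) : (n (i, x)).1 = (n (i, y)).1 := by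
  obtain ⟨s, hs⟩ := exists_apply_mul_of_mem_normalizerR hn (x⁻¹ * y)
  simpa using (congrArg Prod.fst (hs i x)).symm

theorem normalizerR_eq_top_of_subsingleton [Subsingleton G] : normalizerR m G = ⊤ := by
  have h_bot : rightRegular m G = ⊥ := by
    rw [eq_bot_iff]
    rintro _ ⟨g, rfl⟩
    exact Equiv.ext fun u => Prod.ext rfl (Subsingleton.elim _ _)
  rw [normalizerR, h_bot]
  exact Subgroup.normalizer_eq_top (H := ⊥)

theorem isMDCIGroup_of_subsingleton [Subsingleton G] : IsMDCIGroup m G := by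
  rintro Γ - Δ - ⟨φ⟩
  exact ⟨φ.toEquiv, normalizerR_eq_top_of_subsingleton (G := G) ▸ Subgroup.mem_top _,
    image_eq_iff.2 fun _ _ => φ.map_rel_iff.symm⟩

theorem IsMDCIGroup.isMCIGroup (hG : IsMDCIGroup m G) : IsMCIGroup m G :=
  fun Γ hΓ Δ hΔ => hG Γ hΓ.1 Δ hΔ.1

end Basic

section CosetExtension

variable {G : Type*} [Group G]

theorem mul_inv_eq_inv_iff {x y g : G} : y * x⁻¹ = g⁻¹ ↔ x * y⁻¹ = g := by
  rw [← inv_inj, inv_inv, mul_inv_rev, inv_inv]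

theorem exists_leftEquivariant_retraction (H : Subgroup G) :
    ∃ r : G → H, ∀ (h : H) (x : G), r (h * x) = h * r x := by
  obtain ⟨T, hT, -⟩ := H.exists_isComplement_right 1
  exact ⟨fun x => (hT.equiv x).1, fun h x => congrArg Prod.fst (hT.equiv_mul_left h x)⟩

theorem mem_zpowers_coe_gen {g : G} (z : Subgroup.zpowers g) :
    z ∈ Subgroup.zpowers (⟨g, Subgroup.mem_zpowers g⟩ : Subgroup.zpowers g) := by
  obtain ⟨_, k, rfl⟩ := z
  exact ⟨k, rfl⟩

theorem exists_map_mul_left_eq {A : Type*} [Group A] {g : G} {a : A}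
    (hag : orderOf a ∣ orderOf g) : ∃ c : G → A, ∀ x, c (g * x) = a * c x := by
  obtain ⟨r, hr⟩ := exists_leftEquivariant_retraction (Subgroup.zpowers g)
  let χ : Subgroup.zpowers g →* A :=
    monoidHomOfForallMemZpowers mem_zpowers_coe_gen (by simpa using hag)
  have hχ : χ ⟨g, Subgroup.mem_zpowers g⟩ = a := monoidHomOfForallMemZpowers_apply_gen _ _
  exact ⟨fun x => χ (r x), fun x => by
    simpa [hχ] using congrArg χ (hr ⟨g, Subgroup.mem_zpowers g⟩ x)⟩

theorem exists_perm_mul_left_eq_of_orderOf_eq [Finite G] {g h : G} (hgh : orderOf g = orderOf h) :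
    ∃ φ : Equiv.Perm G, ∀ x, φ (g * x) = h * φ x := by
  obtain ⟨T, hT, -⟩ := (Subgroup.zpowers g).exists_isComplement_right 1
  obtain ⟨U, hU, -⟩ := (Subgroup.zpowers h).exists_isComplement_right 1
  have card_eq : Nat.card T = Nat.card U := by
    have card_mul_eq := hT.card_mul_card.trans hU.card_mul_card.symm
    simp only [SetLike.coe_sort_coe, Nat.card_zpowers, hgh] at card_mul_eq
    exact Nat.eq_of_mul_eq_mul_left (orderOf_pos h) card_mul_eq
  let e : T ≃ U := (Finite.card_eq.1 card_eq).some
  let α : Subgroup.zpowers g ≃* Subgroup.zpowers h :=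
    mulEquivOfOrderOfEq mem_zpowers_coe_gen mem_zpowers_coe_gen (by simpa using hgh)
  have hα : α ⟨g, Subgroup.mem_zpowers g⟩ = ⟨h, Subgroup.mem_zpowers h⟩ :=
    mulEquivOfOrderOfEq_apply_gen ..
  refine ⟨hT.equiv.trans ((Equiv.prodCongr α.toEquiv e).trans hU.equiv.symm), fun x => ?_⟩
  have hx := hT.equiv_mul_left ⟨g, Subgroup.mem_zpowers g⟩ x
  have hU_symm (z : Subgroup.zpowers h) (u : U) : hU.equiv.symm (z, u) = (z * u : G) := rfl
  simp only at hx
  simp [hx, hα, hU_symm, Prod.map, mul_assoc]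

theorem mul_inv_mem_iff_of_mul_inv_mem {H : Subgroup G} {x x' y y' : G} (hx : x' * x⁻¹ ∈ H)
    (hy : y' * y⁻¹ ∈ H) : y' * x'⁻¹ ∈ H ↔ y * x⁻¹ ∈ H := by
  have h_factor : y' * x'⁻¹ = y' * y⁻¹ * (y * x⁻¹) * (x' * x⁻¹)⁻¹ := by group
  rw [h_factor, H.mul_mem_cancel_right (inv_mem hx), H.mul_mem_cancel_left hy]

theorem exists_perm_extending_cayley_iso {H : Subgroup G} {X Y : Set G} (hX : X ⊆ H) (hY : Y ⊆ H)
    (φ : Equiv.Perm H)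
    (hφ : ∀ a b : H, (b * a⁻¹ : G) ∈ X ↔ (φ b * (φ a : G)⁻¹ : G) ∈ Y) :
    ∃ f : Equiv.Perm G, (∀ x, f x * x⁻¹ ∈ H) ∧
      ∀ x y, y * x⁻¹ ∈ X ↔ f y * (f x)⁻¹ ∈ Y := by
  obtain ⟨r, hr⟩ := exists_leftEquivariant_retraction H
  have hr' (a : H) (x : G) : r (a * ((r x : G)⁻¹ * x)) = a := by
    simpa [mul_assoc] using hr (a * (r x)⁻¹) x
  let f : Equiv.Perm G :=
    { toFun := fun x => φ (r x) * ((r x : G)⁻¹ * x)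
      invFun := fun x => φ.symm (r x) * ((r x : G)⁻¹ * x)
      left_inv := fun x => by simp [hr']
      right_inv := fun x => by simp [hr'] }
  have hfH (x : G) : f x * x⁻¹ ∈ H := by
    simpa [f, mul_assoc] using (φ (r x) * (r x)⁻¹).2
  refine ⟨f, hfH, fun x y => ?_⟩
  by_cases hxy : y * x⁻¹ ∈ H
  · obtain ⟨h, rfl⟩ : ∃ h : H, y = h * x := ⟨⟨_, hxy⟩, by simp⟩
    simpa [f, hr, mul_assoc] using hφ (r x) (h * r x)
  · have hfxy : f y * (f x)⁻¹ ∉ H := mt (mul_inv_mem_iff_of_mul_inv_mem (hfH x) (hfH y)).1 hxy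
    exact iff_of_false (mt (@hX _) hxy) (mt (@hY _) hfxy)

theorem exists_finite_isMulCommutative_subgroup {g h : G} (hg : IsOfFinOrder g)
    (hh : IsOfFinOrder h) (hgh : Commute g h) :
    ∃ H : Subgroup G, Finite H ∧ IsMulCommutative H ∧ g ∈ H ∧ h ∈ H := by
  have : Finite (Subgroup.zpowers g) := hg.finite_zpowers
  have : Finite (Subgroup.zpowers h) := hh.finite_zpowers
  let μ := (Subgroup.zpowers g).subtype.noncommCoprod (Subgroup.zpowers h).subtype (by
    rintro ⟨_, k, rfl⟩ ⟨_, l, rfl⟩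
    exact hgh.zpow_zpow k l)
  exact ⟨μ.range, Finite.of_surjective _ μ.rangeRestrict_surjective, inferInstance,
    ⟨(⟨g, Subgroup.mem_zpowers g⟩, 1), by simp [μ]⟩,
    ⟨(1, ⟨h, Subgroup.mem_zpowers h⟩), by simp [μ]⟩⟩

end CosetExtension

section TwistedCycles

variable {m : ℕ} {G : Type*} [Group G]

/-- The connection sets of the `m`-Cayley graph with edges `x_i — (g x)_{σ i}`, a union of cycles or
two-way infinite paths that visit the copies of `G` along the orbits of `σ`. -/
def twistedCycles (σ : Equiv.Perm (Fin m)) (g : G) : Fin m → Fin m → Set G :=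
  fun i j => {s | (j = σ i ∧ s = g) ∨ (i = σ j ∧ s = g⁻¹)}

theorem isMCayleyGraph_cay_twistedCycles (σ : Equiv.Perm (Fin m)) {g : G} (hg : g ≠ 1) :
    IsMCayleyGraph (cay (twistedCycles σ g)) := by
  refine isMCayleyGraph_cay (fun i => ?_) fun i j => ?_
  · simp [twistedCycles, hg, hg.symm]
  · ext s
    simp [twistedCycles, inv_eq_iff_eq_inv, or_comm]

theorem isomorphic_cay_twistedCycles {σ : Equiv.Perm (Fin m)} {g : G}
    (hσ : orderOf σ ∣ orderOf g) :
    Isomorphic (cay (twistedCycles 1 g)) (cay (twistedCycles σ g)) := by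
  obtain ⟨c, hc⟩ := exists_map_mul_left_eq hσ
  have arc_iff (i j : Fin m) (x y : G) :
      c y j = σ (c x i) ∧ y * x⁻¹ = g ↔ j = i ∧ y * x⁻¹ = g := by
    refine and_congr_left fun hyx => ?_
    rw [mul_inv_eq_iff_eq_mul.1 hyx, hc, Equiv.Perm.mul_apply, σ.injective.eq_iff,
      (c x).injective.eq_iff]
  refine ⟨⟨Equiv.prodCongrLeft c, ?_⟩⟩
  rintro ⟨i, x⟩ ⟨j, y⟩
  simp only [cay_adj, twistedCycles, Set.mem_ofPred_eq, Equiv.prodCongrLeft_apply,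
    mul_inv_eq_inv_iff, arc_iff, Equiv.Perm.one_apply]

theorem not_isMCIGroup_of_orderOf_perm_dvd {σ : Equiv.Perm (Fin m)} {g : G} (hσ : σ ≠ 1)
    (hσg : orderOf σ ∣ orderOf g) : ¬ IsMCIGroup m G := by
  intro hG
  have hg : g ≠ 1 := by
    rintro rfl
    simp [hσ] at hσg
  obtain ⟨n, hn, hn_image⟩ := hG _ (isMCayleyGraph_cay_twistedCycles 1 hg) _
    (isMCayleyGraph_cay_twistedCycles σ hg) (isomorphic_cay_twistedCycles hσg)
  obtain ⟨i, hi⟩ : ∃ i, σ i ≠ i := by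
    by_contra! h
    exact hσ (Equiv.ext h)
  obtain ⟨⟨j, x⟩, hjx⟩ := n.surjective (i, 1)
  obtain ⟨⟨k, y⟩, hky⟩ := n.surjective (σ i, g)
  have adj : (cay (twistedCycles 1 g)).Adj (j, x) (k, y) := by
    rw [image_eq_iff.1 hn_image, hjx, hky, cay_adj]
    simp [twistedCycles]
  obtain rfl : k = j := by
    rw [cay_adj] at adj
    rcases adj with ⟨h, -⟩ | ⟨h, -⟩
    exacts [h, h.symm]
  apply hi
  simpa [hjx, hky] using fst_apply_eq_of_mem_normalizerR hn k y x

theorem IsMCIGroup.lt_of_prime_dvd_orderOf (hG : IsMCIGroup m G) {p : ℕ} (hp : p.Prime) {g : G}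
    (hpg : p ∣ orderOf g) : m < p := by
  by_contra! hpm
  have : Fact p.Prime := ⟨hp⟩
  obtain ⟨σ, hσ⟩ := exists_prime_orderOf_dvd_card' (G := Equiv.Perm (Fin m)) p (by
    rw [Nat.card_perm, Nat.card_fin]
    exact hp.dvd_factorial.2 hpm)
  refine not_isMCIGroup_of_orderOf_perm_dvd (σ := σ) (g := g) ?_ (hσ ▸ hpg) hG
  rintro rfl
  exact hp.ne_one (by simpa using hσ.symm)

end TwistedCycles

section CosetJoin

variable {m : ℕ} {G : Type*} [Group G]

/-- The connection sets of the `m`-Cayley digraph that induces `Cay(G, X_i)` on the `i`-th copy of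
`G` and joins `x_i` to every vertex of `(H x)_j` for `j ≠ i`. -/
def cosetJoin (H : Subgroup G) (X : Fin m → Set G) : Fin m → Fin m → Set G :=
  fun i j => if i = j then X i else H

theorem isMCayleyDigraph_cay_cosetJoin (H : Subgroup G) {X : Fin m → Set G}
    (hX : ∀ i, (1 : G) ∉ X i) : IsMCayleyDigraph (cay (cosetJoin H X)) :=
  ⟨cosetJoin H X, by simpa [cosetJoin] using hX, rfl⟩

theorem isMCayleyGraph_cay_cosetJoin (H : Subgroup G) {X : Fin m → Set G}
    (hX : ∀ i, (1 : G) ∉ X i) (hX_inv : ∀ i, (X i)⁻¹ = X i) :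
    IsMCayleyGraph (cay (cosetJoin H X)) := by
  refine isMCayleyGraph_cay (by simpa [cosetJoin] using hX) fun i j => ?_
  rcases eq_or_ne i j with rfl | hij
  · simp [cosetJoin, hX_inv]
  · simp [cosetJoin, hij, hij.symm]

theorem isomorphic_cay_cosetJoin {H : Subgroup G} {X Y : Fin m → Set G} (hX : ∀ i, X i ⊆ H)
    (hY : ∀ i, Y i ⊆ H) (φ : Fin m → Equiv.Perm H)
    (hφ : ∀ i (a b : H), (b * a⁻¹ : G) ∈ X i ↔ (φ i b * (φ i a : G)⁻¹ : G) ∈ Y i) :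
    Isomorphic (cay (cosetJoin H X)) (cay (cosetJoin H Y)) := by
  choose f hfH hfXY using fun i => exists_perm_extending_cayley_iso (hX i) (hY i) (φ i) (hφ i)
  refine ⟨⟨Equiv.prodCongrRight f, ?_⟩⟩
  rintro ⟨i, x⟩ ⟨j, y⟩
  simp only [cay_adj, cosetJoin, Equiv.prodCongrRight_apply]
  split_ifs with hij
  · subst hij
    exact (hfXY i x y).symm
  · exact mul_inv_mem_iff_of_mul_inv_mem (hfH i x) (hfH j y)

theorem inter_nonempty_of_image_cay_cosetJoin_eq {H : Subgroup G} [IsMulCommutative H] {X : Set G}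
    {Y : Fin m → Set G} (hXH : X ⊆ H) (hX : X.Nonempty) {n : Equiv.Perm (Vertex m G)}
    (hn : n ∈ normalizerR m G)
    (h_image : image (cay (cosetJoin H fun _ => X)) n = cay (cosetJoin H Y))
    {p q : Fin m} (hpq : p ≠ q) : (Y p ∩ Y q).Nonempty := by
  obtain ⟨⟨i, a⟩, ha⟩ := n.surjective (p, 1)
  obtain ⟨⟨j, b⟩, hb⟩ := n.surjective (q, 1)
  rw [image_eq_iff] at h_image
  have hij : i ≠ j := by
    rintro rfl
    apply hpq
    simpa [ha, hb] using fst_apply_eq_of_mem_normalizerR hn i a b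
  have hba : b * a⁻¹ ∈ H := by
    have h := (h_image (i, a) (j, b)).2 (by simp [ha, hb, cay_adj, cosetJoin, hpq])
    simpa [cay_adj, cosetJoin, hij] using h
  obtain ⟨g, hg⟩ := hX
  have b_conj : b * (a⁻¹ * g * a) * b⁻¹ = g := by
    have h_comm := setLike_mul_comm hba (hXH hg)
    calc b * (a⁻¹ * g * a) * b⁻¹ = b * a⁻¹ * g * (b * a⁻¹)⁻¹ := by group
      _ = g := by rw [h_comm, mul_inv_cancel_right]
  obtain ⟨s, hs⟩ := exists_apply_mul_of_mem_normalizerR hn (a⁻¹ * g * a)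
  refine ⟨s, ?_, ?_⟩
  · have h := (h_image (i, a) (i, a * (a⁻¹ * g * a))).1
      (by simpa [cay_adj, cosetJoin, mul_assoc] using hg)
    simpa [hs, ha, cay_adj, cosetJoin] using h
  · have h := (h_image (j, b) (j, b * (a⁻¹ * g * a))).1
      (by simpa [cay_adj, cosetJoin, b_conj] using hg)
    simpa [hs, hb, cay_adj, cosetJoin] using h

theorem isomorphic_cay_cosetJoin_update {H : Subgroup G} {X Y : Set G} (hX : X ⊆ H) (hY : Y ⊆ H)
    (φ : Equiv.Perm H) (hφ : ∀ a b : H, (b * a⁻¹ : G) ∈ X ↔ (φ b * (φ a : G)⁻¹ : G) ∈ Y)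
    (q : Fin m) :
    Isomorphic (cay (cosetJoin H fun _ => X))
      (cay (cosetJoin H (Function.update (fun _ => X) q Y))) := by
  refine isomorphic_cay_cosetJoin (fun _ => hX) (fun i => ?_)
    (Function.update (fun _ => Equiv.refl H) q φ) fun i a b => ?_
  · rcases eq_or_ne i q with rfl | hi
    · simpa using hY
    · simpa [hi] using hX
  · rcases eq_or_ne i q with rfl | hi
    · simpa using hφ a b
    · simp [hi]

theorem IsMCIGroup.inter_nonempty (hm : 2 ≤ m) (hG : IsMCIGroup m G) {H : Subgroup G}
    [IsMulCommutative H] {X Y : Set G} (hXH : X ⊆ H) (hYH : Y ⊆ H) (hX_one : (1 : G) ∉ X)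
    (hY_one : (1 : G) ∉ Y) (hX_inv : X⁻¹ = X) (hY_inv : Y⁻¹ = Y) (hX : X.Nonempty)
    (φ : Equiv.Perm H) (hφ : ∀ a b : H, (b * a⁻¹ : G) ∈ X ↔ (φ b * (φ a : G)⁻¹ : G) ∈ Y) :
    (X ∩ Y).Nonempty := by
  have := Fin.nontrivial_iff_two_le.2 hm
  obtain ⟨p, q, hpq⟩ := exists_pair_ne (Fin m)
  obtain ⟨n, hn, h_image⟩ := hG _
    (isMCayleyGraph_cay_cosetJoin H (fun _ => hX_one) fun _ => hX_inv) _
    (isMCayleyGraph_cay_cosetJoin H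
      ((Function.forall_update_iff _ (p := fun _ Z => (1 : G) ∉ Z)).2 ⟨hY_one, fun _ _ => hX_one⟩)
      ((Function.forall_update_iff _ (p := fun _ Z => Z⁻¹ = Z)).2 ⟨hY_inv, fun _ _ => hX_inv⟩))
    (isomorphic_cay_cosetJoin_update hXH hYH φ hφ q)
  simpa [hpq] using inter_nonempty_of_image_cay_cosetJoin_eq hXH hX hn h_image hpq

theorem IsMDCIGroup.inter_nonempty (hm : 2 ≤ m) (hG : IsMDCIGroup m G) {H : Subgroup G}
    [IsMulCommutative H] {X Y : Set G} (hXH : X ⊆ H) (hYH : Y ⊆ H) (hX_one : (1 : G) ∉ X)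
    (hY_one : (1 : G) ∉ Y) (hX : X.Nonempty) (φ : Equiv.Perm H)
    (hφ : ∀ a b : H, (b * a⁻¹ : G) ∈ X ↔ (φ b * (φ a : G)⁻¹ : G) ∈ Y) :
    (X ∩ Y).Nonempty := by
  have := Fin.nontrivial_iff_two_le.2 hm
  obtain ⟨p, q, hpq⟩ := exists_pair_ne (Fin m)
  obtain ⟨n, hn, h_image⟩ := hG _ (isMCayleyDigraph_cay_cosetJoin H fun _ => hX_one) _
    (isMCayleyDigraph_cay_cosetJoin H
      ((Function.forall_update_iff _ (p := fun _ Z => (1 : G) ∉ Z)).2 ⟨hY_one, fun _ _ => hX_one⟩))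
    (isomorphic_cay_cosetJoin_update hXH hYH φ hφ q)
  simpa [hpq] using inter_nonempty_of_image_cay_cosetJoin_eq hXH hX hn h_image hpq

end CosetJoin

section Consequences

variable {m : ℕ} {G : Type*} [Group G]

theorem IsMDCIGroup.inv_eq_self (hm : 2 ≤ m) (hG : IsMDCIGroup m G) (g : G) : g⁻¹ = g := by
  rcases eq_or_ne g 1 with rfl | hg
  · exact inv_one
  let H := Subgroup.zpowers g
  have inv_mem_iff (a b : H) : (b * a⁻¹ : G) ∈ ({g} : Set G) ↔
      ((Equiv.inv H b : H) * ((Equiv.inv H a : H) : G)⁻¹ : G) ∈ ({g⁻¹} : Set G) := by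
    have h_comm : (a : G)⁻¹ * b = b * (a : G)⁻¹ := setLike_mul_comm (inv_mem a.2) b.2
    simp [h_comm, ← inv_inj (b := g⁻¹)]
  have h_inter := hG.inter_nonempty hm (H := H) (X := {g}) (Y := {g⁻¹})
    (by simp [H]) (by simp [H]) (by simpa using hg.symm) (by simpa using hg)
    (Set.singleton_nonempty g) (Equiv.inv H) inv_mem_iff
  simpa using h_inter

theorem IsMCIGroup.not_two_dvd_orderOf (hm : 2 ≤ m) (hG : IsMCIGroup m G) (g : G) :
    ¬ 2 ∣ orderOf g :=
  fun hg => hm.not_gt (hG.lt_of_prime_dvd_orderOf Nat.prime_two hg)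

theorem IsMCIGroup.isOfFinOrder (hm : 2 ≤ m) (hG : IsMCIGroup m G) (g : G) : IsOfFinOrder g := by
  rw [← orderOf_ne_zero_iff]
  intro hg
  exact hG.not_two_dvd_orderOf hm g (hg ▸ dvd_zero 2)

theorem IsMDCIGroup.subsingleton (hm : 2 ≤ m) (hG : IsMDCIGroup m G) : Subsingleton G := by
  refine subsingleton_of_forall_eq 1 fun g => ?_
  have g_sq : g ^ 2 = 1 := by
    rw [pow_two, mul_eq_one_iff_eq_inv, hG.inv_eq_self hm]
  rcases (Nat.dvd_prime Nat.prime_two).1 (orderOf_dvd_of_pow_eq_one g_sq) with h | h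
  · exact orderOf_eq_one_iff.1 h
  · exact absurd h.symm.dvd (hG.isMCIGroup.not_two_dvd_orderOf hm g)

theorem IsMCIGroup.eq_or_eq_inv_of_commute (hm : 2 ≤ m) (hG : IsMCIGroup m G) {g h : G}
    (h_comm : Commute g h) (h_order : orderOf g = orderOf h) : h = g ∨ h = g⁻¹ := by
  rcases eq_or_ne g 1 with rfl | hg
  · left
    rwa [orderOf_one, eq_comm, orderOf_eq_one_iff] at h_order
  have hh : h ≠ 1 := by
    rintro rfl
    rw [orderOf_one, orderOf_eq_one_iff] at h_order
    exact hg h_order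
  obtain ⟨H, _, _, hgH, hhH⟩ := exists_finite_isMulCommutative_subgroup
    (hG.isOfFinOrder hm g) (hG.isOfFinOrder hm h) h_comm
  obtain ⟨φ, hφ⟩ := exists_perm_mul_left_eq_of_orderOf_eq (g := (⟨g, hgH⟩ : H)) (h := ⟨h, hhH⟩)
    (by simpa using h_order)
  have translate_iff (a b : H) : b * (a : G)⁻¹ = g ↔ (φ b * (φ a : G)⁻¹ : G) = h := by
    have h_eq : b = ⟨g, hgH⟩ * a ↔ φ b = ⟨h, hhH⟩ * φ a := by rw [← hφ, φ.injective.eq_iff]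
    simpa [mul_inv_eq_iff_eq_mul, Subtype.ext_iff] using h_eq
  obtain ⟨z, hz, hz'⟩ := hG.inter_nonempty hm (H := H) (X := {g, g⁻¹}) (Y := {h, h⁻¹})
    (by simp [Set.insert_subset_iff, hgH]) (by simp [Set.insert_subset_iff, hhH])
    (by simp [hg, hg.symm]) (by simp [hh, hh.symm])
    (by simp [Set.pair_comm]) (by simp [Set.pair_comm])
    (Set.insert_nonempty _ _) φ fun a b => by simp [mul_inv_eq_inv_iff, translate_iff]
  rcases hz with rfl | rfl <;> rcases hz' with h_eq | h_eq <;> simp_all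

theorem IsMCIGroup.orderOf_eq_three (hm : 2 ≤ m) (hG : IsMCIGroup m G) {g : G} (hg : g ≠ 1) :
    orderOf g = 3 := by
  have h_coprime : (orderOf g).Coprime 2 :=
    (Nat.prime_two.coprime_iff_not_dvd.2 (hG.not_two_dvd_orderOf hm g)).symm
  rcases hG.eq_or_eq_inv_of_commute hm ((Commute.refl g).pow_right 2)
    h_coprime.orderOf_pow.symm with h_sq | h_sq
  · exact absurd (by simpa [pow_two] using h_sq) hg
  · exact orderOf_eq_prime (by rw [pow_succ, h_sq, inv_mul_cancel]) hg

theorem inv_eq_mul_self_of_pow_three_eq_one {x : G} (h_cube : x ^ 3 = 1) : x⁻¹ = x * x := by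
  rw [inv_eq_iff_mul_eq_one, ← h_cube, pow_three]

theorem mul_mul_self_of_mul_pow_three_eq_one {x y : G} (h_cube : (x * y) ^ 3 = 1) :
    x * y * x = y⁻¹ * x⁻¹ * y⁻¹ := by
  rw [← mul_inv_eq_one, ← h_cube, pow_three]
  group

theorem commute_conj_of_forall_pow_three_eq_one (h_cube : ∀ g : G, g ^ 3 = 1) (x y : G) :
    Commute x (y * x * y⁻¹) := by
  have y_inv := inv_eq_mul_self_of_pow_three_eq_one (h_cube y)
  have h_left : x * (y * x * y⁻¹) = y⁻¹ * x⁻¹ * y := calc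
    x * (y * x * y⁻¹) = x * y * x * y⁻¹ := by group
    _ = y⁻¹ * x⁻¹ * (y⁻¹ * y⁻¹) := by
      rw [mul_mul_self_of_mul_pow_three_eq_one (h_cube (x * y))]; group
    _ = y⁻¹ * x⁻¹ * y := by rw [← mul_inv_rev y y, ← y_inv, inv_inv]
  have h_right : y * x * y⁻¹ * x = y⁻¹ * x⁻¹ * y := calc
    y * x * y⁻¹ * x = y * (x * y⁻¹ * x) := by group
    _ = y * y * x⁻¹ * y := by
      rw [mul_mul_self_of_mul_pow_three_eq_one (h_cube (x * y⁻¹))]; group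
    _ = y⁻¹ * x⁻¹ * y := by rw [← y_inv]
  exact h_left.trans h_right.symm

theorem IsMCIGroup.pow_three_eq_one (hm : 2 ≤ m) (hG : IsMCIGroup m G) (g : G) : g ^ 3 = 1 := by
  rcases eq_or_ne g 1 with rfl | hg
  · exact one_pow 3
  · exact hG.orderOf_eq_three hm hg ▸ pow_orderOf_eq_one g

theorem IsMCIGroup.commute (hm : 2 ≤ m) (hG : IsMCIGroup m G) (x y : G) : Commute x y := by
  have h_conj : y * x * y⁻¹ = x ∨ y * x * y⁻¹ = x⁻¹ :=
    hG.eq_or_eq_inv_of_commute hm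
      (commute_conj_of_forall_pow_three_eq_one (hG.pow_three_eq_one hm) x y)
      ((MulAut.conj y).orderOf_eq x).symm
  rcases h_conj with h | h
  · exact (mul_inv_eq_iff_eq_mul.1 h).symm
  · have y_semiconj : SemiconjBy y x x⁻¹ := mul_inv_eq_iff_eq_mul.1 h
    have y_semiconj_inv : SemiconjBy y x⁻¹ x := by simpa using y_semiconj.inv_right
    have y_sq_comm : Commute (y * y) x := y_semiconj_inv.mul_left y_semiconj
    rw [← inv_eq_mul_self_of_pow_three_eq_one (hG.pow_three_eq_one hm y)] at y_sq_comm
    exact (Commute.inv_left_iff.1 y_sq_comm).symm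

theorem IsMCIGroup.eq_two_and_card_eq_three [Nontrivial G] (hm : 2 ≤ m) (hG : IsMCIGroup m G) :
    m = 2 ∧ Nat.card G = 3 := by
  obtain ⟨g, hg⟩ := exists_ne (1 : G)
  have hg_order := hG.orderOf_eq_three hm hg
  have hm_lt : m < 3 := hG.lt_of_prime_dvd_orderOf Nat.prime_three hg_order.symm.dvd
  refine ⟨by lia, ?_⟩
  rw [← hg_order, eq_comm]
  refine orderOf_eq_card_of_forall_mem_zpowers fun h => ?_
  rcases eq_or_ne h 1 with rfl | hh
  · exact one_mem _
  · rcases hG.eq_or_eq_inv_of_commute hm (hG.commute hm g h)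
      (hg_order.trans (hG.orderOf_eq_three hm hh).symm) with rfl | rfl
    · exact Subgroup.mem_zpowers _
    · exact inv_mem (Subgroup.mem_zpowers g)

end Consequences

section LeftMulPerm

variable {m : ℕ} {G : Type*} [Group G]

/-- The permutation `x_i ↦ (c_i x)_{π i}` of the vertices. These are the elements of the centralizer
of `R(G)`. -/
def leftMulPerm (π : Equiv.Perm (Fin m)) (c : Fin m → G) : Equiv.Perm (Vertex m G) :=
  Equiv.prodShear π fun i => Equiv.mulLeft (c i)

theorem leftMulPerm_apply (π : Equiv.Perm (Fin m)) (c : Fin m → G) (u : Vertex m G) :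
    leftMulPerm π c u = (π u.1, c u.1 * u.2) := rfl

theorem leftMulPerm_mem_normalizerR (π : Equiv.Perm (Fin m)) (c : Fin m → G) :
    leftMulPerm π c ∈ normalizerR m G := by
  refine Subgroup.centralizer_le_normalizer _ (Subgroup.mem_centralizer_iff.2 ?_)
  rintro _ ⟨g, rfl⟩
  ext u <;> simp [leftMulPerm_apply, rightMul, mul_assoc]

theorem image_cay_leftMulPerm {S T : Fin m → Fin m → Set G} {π : Equiv.Perm (Fin m)} {c : Fin m → G}
    (hST : ∀ i j s, s ∈ S i j ↔ c j * s * (c i)⁻¹ ∈ T (π i) (π j)) :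
    image (cay S) (leftMulPerm π c) = cay T := by
  refine image_eq_iff.2 fun u v => ?_
  simp [cay_adj, hST, leftMulPerm_apply, mul_assoc]

end LeftMulPerm

section Invariants

variable {V : Type*} {Γ Δ : Digraph V} {m : ℕ} {G : Type*} [Group G]

/-- The number of arcs leaving `u`, and `0` if there are infinitely many. -/
noncomputable def outDegree (Γ : Digraph V) (u : V) : ℕ :=
  Nat.card {v // Γ.Adj u v}

theorem outDegree_apply_iso (φ : Γ.Adj ≃r Δ.Adj) (u : V) :
    outDegree Δ (φ u) = outDegree Γ u :=
  (Nat.card_congr (φ.toEquiv.subtypeEquiv fun _ => φ.map_rel_iff.symm)).symm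

theorem range_outDegree_eq (φ : Γ.Adj ≃r Δ.Adj) :
    Set.range (outDegree Γ) = Set.range (outDegree Δ) := by
  rw [← φ.surjective.range_comp (outDegree Δ)]
  exact congrArg Set.range (funext fun u => (outDegree_apply_iso φ u).symm)

theorem outDegree_cay [Finite G] (S : Fin m → Fin m → Set G) (u : Vertex m G) :
    outDegree (cay S) u = ∑ j, (S u.1 j).ncard := by
  let e : {v // (cay S).Adj u v} ≃ Σ j, S u.1 j :=
    { toFun := fun v => ⟨v.1.1, v.1.2 * u.2⁻¹, cay_adj.1 v.2⟩
      invFun := fun s => ⟨(s.1, s.2 * u.2), cay_adj.2 (by simp)⟩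
      left_inv := fun v => by simp
      right_inv := fun s => by simp }
  rw [outDegree, Nat.card_congr e, Nat.card_sigma]
  rfl

/-- Some three vertices form a transitive triangle; in a loopless graph these are the triangles. -/
def HasTriangle (Γ : Digraph V) : Prop :=
  ∃ u v w, Γ.Adj u v ∧ Γ.Adj v w ∧ Γ.Adj u w

theorem HasTriangle.map (φ : Γ.Adj ≃r Δ.Adj) (h : HasTriangle Γ) : HasTriangle Δ := by
  obtain ⟨u, v, w, huv, hvw, huw⟩ := h
  exact ⟨φ u, φ v, φ w, φ.map_rel_iff.2 huv, φ.map_rel_iff.2 hvw, φ.map_rel_iff.2 huw⟩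

theorem hasTriangle_iff_of_iso (φ : Γ.Adj ≃r Δ.Adj) : HasTriangle Γ ↔ HasTriangle Δ :=
  ⟨.map φ, .map φ.symm⟩

theorem hasTriangle_cay_iff (h_cube : ∀ g : G, g ^ 3 = 1) {S : Fin 2 → Fin 2 → Set G}
    (hS : ∀ i j, (S i j)⁻¹ = S j i) : HasTriangle (cay S) ↔ ∃ i, (S i i).Nonempty := by
  constructor
  · rintro ⟨u, v, w, huv, hvw, huw⟩
    rw [cay_adj] at huv hvw huw
    have pigeonhole : u.1 = v.1 ∨ v.1 = w.1 ∨ u.1 = w.1 := by omega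
    rcases pigeonhole with h | h | h
    · exact ⟨v.1, _, h ▸ huv⟩
    · exact ⟨w.1, _, h ▸ hvw⟩
    · exact ⟨w.1, _, h ▸ huw⟩
  · rintro ⟨i, g, hg⟩
    have hg_sq : g * g ∈ S i i := by
      rwa [← inv_eq_mul_self_of_pow_three_eq_one (h_cube g), ← Set.mem_inv, hS]
    exact ⟨(i, 1), (i, g), (i, g * g), by simpa [cay_adj], by simpa [cay_adj], by simpa [cay_adj]⟩

end Invariants

section OrderThree

variable {G : Type*} [Group G]

theorem eq_or_eq_inv_of_card_eq_three (hcard : Nat.card G = 3) {x y : G} (hx : x ≠ 1)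
    (hy : y ≠ 1) : y = x ∨ y = x⁻¹ := by
  have : Fact (Nat.Prime 3) := ⟨Nat.prime_three⟩
  have x_cube : x ^ 3 = 1 := hcard ▸ pow_card_eq_one'
  obtain ⟨k, hk, rfl⟩ : ∃ k < 3, x ^ k = y := by
    have : Finite G := Nat.finite_of_card_ne_zero (by lia)
    classical
    have hyx : y ∈ Subgroup.zpowers x := mem_zpowers_of_prime_card hcard hx
    simpa [mem_zpowers_iff_mem_range_orderOf, orderOf_eq_prime x_cube hx] using hyx
  interval_cases k
  · simp at hy
  · simp
  · right
    rw [inv_eq_mul_self_of_pow_three_eq_one x_cube, pow_two]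

theorem eq_empty_or_eq_compl_one_of_inv_eq_self (hcard : Nat.card G = 3) {A : Set G}
    (h_one : (1 : G) ∉ A) (h_inv : A⁻¹ = A) : A = ∅ ∨ A = {1}ᶜ := by
  rcases A.eq_empty_or_nonempty with h_empty | ⟨x, hx⟩
  · exact Or.inl h_empty
  refine Or.inr ((Set.subset_compl_singleton_iff.2 h_one).antisymm fun y hy => ?_)
  rcases eq_or_eq_inv_of_card_eq_three hcard (ne_of_mem_of_not_mem hx h_one) hy with rfl | rfl
  · exact hx
  · rwa [← Set.mem_inv, h_inv]

theorem exists_smul_eq_of_ncard_le_one [Finite G] {A B : Set G} (h_le : A.ncard ≤ 1)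
    (h_eq : A.ncard = B.ncard) : ∃ c : G, c • A = B := by
  rcases Nat.le_one_iff_eq_zero_or_eq_one.1 h_le with hA | hA
  · have hB : B.ncard = 0 := h_eq ▸ hA
    rw [Set.ncard_eq_zero] at hA hB
    exact ⟨1, by simp [hA, hB]⟩
  · obtain ⟨a, rfl⟩ := Set.ncard_eq_one.1 hA
    obtain ⟨b, rfl⟩ := Set.ncard_eq_one.1 (h_eq ▸ hA)
    exact ⟨b * a⁻¹, by simp⟩

theorem exists_smul_eq_of_card_le_three [Finite G] (hcard : Nat.card G ≤ 3) {A B : Set G}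
    (h_eq : A.ncard = B.ncard) : ∃ c : G, c • A = B := by
  rcases le_or_gt A.ncard 1 with h_le | h_lt
  · exact exists_smul_eq_of_ncard_le_one h_le h_eq
  · have hA := Set.ncard_add_ncard_compl A
    have hB := Set.ncard_add_ncard_compl B
    obtain ⟨c, hc⟩ := exists_smul_eq_of_ncard_le_one (A := Aᶜ) (B := Bᶜ) (by lia) (by lia)
    exact ⟨c, compl_injective (by rw [← hc, Set.smul_set_compl])⟩

theorem exists_perm_comp_eq_of_range_eq {α : Type*} {s t : Fin 2 → α}
    (h_range : Set.range s = Set.range t) : ∃ π : Equiv.Perm (Fin 2), ∀ i, s i = t (π i) := by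
  have range_eq (f : Fin 2 → α) : Set.range f = {f 0, f 1} := by
    ext; simp [eq_comm]
  rw [range_eq, range_eq, Set.pair_eq_pair_iff] at h_range
  rcases h_range with h | h
  · exact ⟨1, by simpa [Fin.forall_fin_two] using h⟩
  · exact ⟨Equiv.swap 0 1, by simpa [Fin.forall_fin_two] using h⟩

theorem le_of_range_add_subset {ι : Type*} {d a b : ℕ} {s t : ι → ℕ} (hs : ∃ i, s i = d)
    (ht : ∀ i, t i ≤ d)
    (h_range : Set.range (fun i => s i + a) ⊆ Set.range fun i => t i + b) : a ≤ b := by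
  obtain ⟨i, hi⟩ := hs
  obtain ⟨j, hj : t j + b = s i + a⟩ := h_range ⟨i, rfl⟩
  have := ht j
  lia

theorem eq_of_range_add_eq {ι : Type*} [Nonempty ι] {d a b : ℕ} {s t : ι → ℕ}
    (hs : ∀ i, s i = 0 ∨ s i = d) (ht : ∀ i, t i = 0 ∨ t i = d)
    (h_iff : (∃ i, s i ≠ 0) ↔ ∃ i, t i ≠ 0)
    (h_range : Set.range (fun i => s i + a) = Set.range fun i => t i + b) : a = b := by
  have max_eq : ∃ e, (∃ i, s i = e) ∧ (∃ i, t i = e) ∧ (∀ i, s i ≤ e) ∧ ∀ i, t i ≤ e := by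
    by_cases h : ∃ i, s i ≠ 0
    · obtain ⟨i, hi⟩ := h
      obtain ⟨j, hj⟩ := h_iff.1 ⟨i, hi⟩
      exact ⟨d, ⟨i, (hs i).resolve_left hi⟩, ⟨j, (ht j).resolve_left hj⟩,
        fun k => by grind, fun k => by grind⟩
    · have ht_zero := mt h_iff.2 h
      push Not at h ht_zero
      exact ⟨0, by simp [h], by simp [ht_zero], by simp [h], by simp [ht_zero]⟩
  obtain ⟨e, hs_max, ht_max, hs_le, ht_le⟩ := max_eq
  exact (le_of_range_add_subset hs_max ht_le h_range.subset).antisymm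
    (le_of_range_add_subset ht_max hs_le h_range.superset)

theorem ncard_eq_ncard_zero_one {S : Fin 2 → Fin 2 → Set G} (hS : ∀ i j, (S i j)⁻¹ = S j i)
    {i j : Fin 2} (hij : i ≠ j) : (S i j).ncard = (S 0 1).ncard := by
  have h_swap : (S 1 0).ncard = (S 0 1).ncard := by rw [← hS 0 1, Set.ncard_inv]
  fin_cases i <;> fin_cases j <;> simp_all

theorem range_outDegree_cay [Finite G] {S : Fin 2 → Fin 2 → Set G} (hS : ∀ i j, (S i j)⁻¹ = S j i) :
    Set.range (outDegree (cay S)) = Set.range fun i => (S i i).ncard + (S 0 1).ncard := by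
  have h_deg (u : Vertex 2 G) : outDegree (cay S) u = (S u.1 u.1).ncard + (S 0 1).ncard := by
    obtain ⟨i, x⟩ := u
    have h_swap := ncard_eq_ncard_zero_one hS (one_ne_zero (α := Fin 2))
    fin_cases i <;> simp [outDegree_cay, h_swap, add_comm]
  rw [funext h_deg]
  exact Prod.fst_surjective.range_comp fun i => (S i i).ncard + (S 0 1).ncard

theorem exists_perm_diag_eq_and_ncard_eq (hcard : Nat.card G = 3) {S T : Fin 2 → Fin 2 → Set G}
    (hS_one : ∀ i, (1 : G) ∉ S i i) (hT_one : ∀ i, (1 : G) ∉ T i i)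
    (hS : ∀ i j, (S i j)⁻¹ = S j i) (hT : ∀ i j, (T i j)⁻¹ = T j i)
    (φ : (cay S).Adj ≃r (cay T).Adj) :
    (∃ π : Equiv.Perm (Fin 2), ∀ i, S i i = T (π i) (π i)) ∧ (S 0 1).ncard = (T 0 1).ncard := by
  have : Finite G := Nat.finite_of_card_ne_zero (by lia)
  have h_cube (g : G) : g ^ 3 = 1 := hcard ▸ pow_card_eq_one'
  have compl_ncard : ({1}ᶜ : Set G).ncard = 2 := by
    rw [Set.ncard_compl, hcard, Set.ncard_singleton]
  have hS_diag i := eq_empty_or_eq_compl_one_of_inv_eq_self hcard (hS_one i) (hS i i)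
  have hT_diag i := eq_empty_or_eq_compl_one_of_inv_eq_self hcard (hT_one i) (hT i i)
  have ncard_eq_zero_or_two {A : Set G} (hA : A = ∅ ∨ A = {1}ᶜ) : A.ncard = 0 ∨ A.ncard = 2 := by
    rcases hA with rfl | rfl <;> simp [compl_ncard]
  have h_range := range_outDegree_eq φ
  rw [range_outDegree_cay hS, range_outDegree_cay hT] at h_range
  -- Valencies alone do not separate a hexagon from two disjoint triangles.
  have h_triangle := hasTriangle_iff_of_iso φ
  rw [hasTriangle_cay_iff h_cube hS, hasTriangle_cay_iff h_cube hT] at h_triangle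
  have h_off : (S 0 1).ncard = (T 0 1).ncard := by
    refine eq_of_range_add_eq (fun i => ncard_eq_zero_or_two (hS_diag i))
      (fun i => ncard_eq_zero_or_two (hT_diag i)) ?_ h_range
    simpa only [← Nat.pos_iff_ne_zero, Set.ncard_pos (Set.toFinite _)] using h_triangle
  refine ⟨?_, h_off⟩
  obtain ⟨π, hπ⟩ := exists_perm_comp_eq_of_range_eq h_range
  refine ⟨π, fun i => ?_⟩
  have h_ncard : (S i i).ncard = (T (π i) (π i)).ncard := by
    simpa [h_off] using hπ i
  rcases hS_diag i with h | h <;> rcases hT_diag (π i) with h' | h' <;> simp_all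

theorem isMCIGroup_two_of_card_eq_three (hcard : Nat.card G = 3) : IsMCIGroup 2 G := by
  have : Finite G := Nat.finite_of_card_ne_zero (by lia)
  rintro _ ⟨⟨S, hS_one, rfl⟩, hS⟩ _ ⟨⟨T, hT_one, rfl⟩, hT⟩ ⟨φ⟩
  rw [isGraph_cay_iff] at hS hT
  obtain ⟨⟨π, h_diag⟩, h_off⟩ := exists_perm_diag_eq_and_ncard_eq hcard hS_one hT_one hS hT φ
  rw [← ncard_eq_ncard_zero_one hT (π.injective.ne zero_ne_one)] at h_off
  obtain ⟨c, hc⟩ := exists_smul_eq_of_card_le_three hcard.le h_off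
  have mem_iff (s : G) : s ∈ S 0 1 ↔ c * s ∈ T (π 0) (π 1) := by
    rw [← hc, ← smul_eq_mul, Set.smul_mem_smul_set_iff]
  have mem_inv_iff (s : G) : s ∈ S 1 0 ↔ s * c⁻¹ ∈ T (π 1) (π 0) := by
    rw [← hS, ← hT, Set.mem_inv, Set.mem_inv, mem_iff, mul_inv_rev, inv_inv]
  have conj_mem_iff (s : G) : s ∈ S 1 1 ↔ c * s * c⁻¹ ∈ T (π 1) (π 1) := by
    rw [← h_diag]
    rcases eq_empty_or_eq_compl_one_of_inv_eq_self hcard (hS_one 1) (hS 1 1) with h | h <;>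
      simp [h]
  refine ⟨leftMulPerm π ![1, c], leftMulPerm_mem_normalizerR _ _,
    image_cay_leftMulPerm fun i j s => ?_⟩
  fin_cases i <;> fin_cases j
  · simp [h_diag]
  · simpa using mem_iff s
  · simpa using mem_inv_iff s
  · simpa using conj_mem_iff s

end OrderThree

end MCayley

theorem mainTheorem2_general (m : ℕ) (hm : 2 ≤ m) (G : Type*) [Group G] :
    (MCayley.IsMCIGroup m G ↔
      (m = 2 ∧ (Subsingleton G ∨ Nonempty (G ≃* Multiplicative (ZMod 3)))) ∨
        (3 ≤ m ∧ Subsingleton G)) ∧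
    (MCayley.IsMDCIGroup m G ↔ Subsingleton G) := by
  have : Fact (Nat.Prime 3) := ⟨Nat.prime_three⟩
  have card_eq_three_iff : Nat.card G = 3 ↔ Nonempty (G ≃* Multiplicative (ZMod 3)) :=
    ⟨fun h => ⟨mulEquivOfPrimeCardEq (p := 3) h (by simp)⟩,
      fun ⟨e⟩ => (Nat.card_congr e.toEquiv).trans (by simp)⟩
  rw [← card_eq_three_iff]
  refine ⟨⟨fun hG => ?_, ?_⟩, fun hG => hG.subsingleton hm,
    fun _ => MCayley.isMDCIGroup_of_subsingleton⟩
  · rcases subsingleton_or_nontrivial G with h_triv | _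
    · have : m = 2 ∨ 3 ≤ m := by lia
      exact this.imp (⟨·, .inl h_triv⟩) (⟨·, h_triv⟩)
    · obtain ⟨rfl, hcard⟩ := hG.eq_two_and_card_eq_three hm
      exact .inl ⟨rfl, .inr hcard⟩
  · rintro (⟨rfl, h_triv | hcard⟩ | ⟨-, h_triv⟩)
    · exact MCayley.isMDCIGroup_of_subsingleton.isMCIGroup
    · exact MCayley.isMCIGroup_two_of_card_eq_three hcard
    · exact MCayley.isMDCIGroup_of_subsingleton.isMCIGroup

theorem mainTheorem2 (m : ℕ) (hm : 2 ≤ m) (G : Type*) [Group G] [Finite G] :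
    (MCayley.IsMCIGroup m G ↔
      (m = 2 ∧ (Subsingleton G ∨ Nonempty (G ≃* Multiplicative (ZMod 3)))) ∨
        (3 ≤ m ∧ Subsingleton G)) ∧
    (MCayley.IsMDCIGroup m G ↔ Subsingleton G) :=
  mainTheorem2_general m hm G
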